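/- Let $G=(V,E)$ be a (finite) ribbon graph, that is, a surface with boundary formed from vertex discs $V$ and edge discs $E$, where each edge disc is glued along two disjoint boundary arcs to the boundaries of vertex discs, all arcs being disjoint. Write $k(G)$ and $f(G)$ for its numbers of connected components and of boundary components. For $A\subseteq E$, let $G^{\tau(A)}$ (the partial Petrial) be obtained by adding a half-twist to each edge in $A$, i.e. by detaching the edge along one of its two arcs and regluing that arc reversed. The Penrose polynomial of $G$ is \[P(G;\lambda)=\sum_{A\subseteq E}(-1)^{|A|}\lambda^{f(G^{\tau(A)})}\in\mathbb Z[\lambda].\] Let $D(G)$ be the set system on $E$ whose feasible sets are the $A\subseteq E$ such that the spanning ribbon subgraph $(V,A)$ has exactly one boundary component in each connected component of $G$. For a set system $D=(E,\mathcal F)$, $e\in E$ and $A\subseteq E$, let $D*A=(E,\{A\bigtriangleup F: F\in\mathcal F\})$ (twist), $D+e=(E,\mathcal F\bigtriangleup\{F\cup e: F\in\mathcal F,\ e\notin F\})$, $D+A=D+a_1+\cdots+a_n$ for $A=\{a_1,\dots,a_n\}$ (loop complementation) and $D\,\bar *\,A=((D*A)+A)*A$. A delta-matroid is a set system with $\mathcal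 F\neq\emptyset$ such that for all $X,Y\in\mathcal F$ and $u\in X\bigtriangleup Y$ there is $v\in X\bigtriangleup Y$ (possibly $v=u$) with $X\bigtriangleup\{u,v\}\in\mathcal F$; $D$ is vf-safe if every sequence of twists and loop complementations applied to $D$ results in a delta-matroid. Let $d_D$ be the rank of the matroid $D_{\min}$ whose bases are the feasible sets of $D$ of minimum size. The Penrose polynomial of a vf-safe delta-matroid $D$ is \[P(D;\lambda)=\sum_{X\subseteq E}(-1)^{|X|}\lambda^{d_{D*E\,\bar *\,X}}.\] Then $D(G)$ is a vf-safe delta-matroid, and \[P(G;\lambda)=\lambda^{k(G)}\,P(D(G);\lambda).\] -/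

import Mathlib

open Polynomial
open scoped symmDiff

/-! ### Set systems and delta-matroids on a finite ground set `E` -/

/-- A set system with ground set `E`: a collection of subsets, the feasible sets. -/
@[ext]
structure SetSystem (E : Type*) where
  feasible : Set (Finset E)

namespace SetSystem

variable {E : Type*} [DecidableEq E]

/-- A delta-matroid: a proper set system satisfying the symmetric exchange axiom
(`v = u` is allowed, and then `{u, v} = {u}`). -/
def IsDeltaMatroid (D : SetSystem E) : Prop :=
  D.feasible.Nonempty ∧
    ∀ X ∈ D.feasible, ∀ Y ∈ D.feasible, ∀ u ∈ X ∆ Y, ∃ v ∈ X ∆ Y, X ∆ {u, v} ∈ D.feasible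

/-- The twist `D * A`. -/
def twist (D : SetSystem E) (A : Finset E) : SetSystem E :=
  ⟨{F | ∃ X ∈ D.feasible, F = A ∆ X}⟩

/-- Loop complementation `D + e` on one element. -/
def loopComplElem (D : SetSystem E) (e : E) : SetSystem E :=
  ⟨D.feasible ∆ {F | ∃ X ∈ D.feasible, e ∉ X ∧ F = insert e X}⟩

theorem mem_loopComplElem (D : SetSystem E) (e : E) (F : Finset E) :
    F ∈ (D.loopComplElem e).feasible ↔
      Xor (F ∈ D.feasible) (e ∈ F ∧ F.erase e ∈ D.feasible) := by
  have h : (∃ X ∈ D.feasible, e ∉ X ∧ F = insert e X) ↔ (e ∈ F ∧ F.erase e ∈ D.feasible) := by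
    constructor
    · rintro ⟨X, hX, heX, rfl⟩
      exact ⟨Finset.mem_insert_self _ _, by rwa [Finset.erase_insert heX]⟩
    · rintro ⟨he, hF⟩
      exact ⟨_, hF, Finset.notMem_erase _ _, (Finset.insert_erase he).symm⟩
  simp only [loopComplElem, Set.mem_symmDiff, Set.mem_ofPred_eq, h, Xor]

theorem loopComplElem_comm (D : SetSystem E) (a b : E) :
    (D.loopComplElem a).loopComplElem b = (D.loopComplElem b).loopComplElem a := by
  rcases eq_or_ne a b with rfl | hab
  · rfl
  · ext F
    simp only [mem_loopComplElem, Finset.mem_erase, ne_eq, hab, hab.symm, not_false_eq_true,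
      true_and, Finset.erase_right_comm (a := a) (b := b)]
    by_cases h1 : F ∈ D.feasible <;> by_cases h2 : a ∈ F <;> by_cases h3 : b ∈ F <;>
      by_cases h4 : F.erase a ∈ D.feasible <;> by_cases h5 : F.erase b ∈ D.feasible <;>
      by_cases h6 : (F.erase b).erase a ∈ D.feasible <;> simp [h1, h2, h3, h4, h5, h6, Xor]

instance : RightCommutative (loopComplElem (E := E)) := ⟨loopComplElem_comm⟩

/-- Loop complementation `D + A = D + a₁ + ⋯ + aₙ` for `A = {a₁, …, aₙ}`. -/
def loopCompl (D : SetSystem E) (A : Finset E) : SetSystem E :=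
  A.val.foldl loopComplElem D

/-- The dual pivot `((D * X) + X) * X`. -/
def dualPivot (D : SetSystem E) (X : Finset E) : SetSystem E :=
  ((D.twist X).loopCompl X).twist X

/-- `D.Reachable D'`: `D'` arises from `D` by a finite sequence of twists and
loop complementations. -/
inductive Reachable (D : SetSystem E) : SetSystem E → Prop
  | refl : Reachable D D
  | twist {D' : SetSystem E} (A : Finset E) : Reachable D D' → Reachable D (D'.twist A)
  | loopCompl {D' : SetSystem E} (A : Finset E) : Reachable D D' → Reachable D (D'.loopCompl A)

/-- A vf-safe delta-matroid: every sequence of twists and loop complementations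
(the empty one included) results in a delta-matroid. -/
def IsVfSafe (D : SetSystem E) : Prop :=
  ∀ D', D.Reachable D' → D'.IsDeltaMatroid

/-- `D_min`: the feasible sets of minimum cardinality. -/
def lower (D : SetSystem E) : SetSystem E :=
  ⟨{F | F ∈ D.feasible ∧ ∀ F' ∈ D.feasible, F.card ≤ F'.card}⟩

/-- The rank of `A`: the size of the largest intersection of `A` with a basis. -/
noncomputable def rank (M : SetSystem E) (A : Finset E) : ℕ :=
  sSup {n | ∃ B ∈ M.feasible, n = (A ∩ B).card}

/-- `d_D = r(D_min)`. -/
noncomputable def lowerRank [Fintype E] (D : SetSystem E) : ℕ :=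
  D.lower.rank Finset.univ

/-- The Penrose polynomial `∑_{X ⊆ E} (-1)^|X| λ^{d_{(D * E) ∗̄ X}}` of a (vf-safe) delta-matroid. -/
noncomputable def penrose [Fintype E] (D : SetSystem E) : ℤ[X] :=
  ∑ A : Finset E, (-1) ^ A.card * X ^ ((D.twist Finset.univ).dualPivot A).lowerRank

end SetSystem

/-! ### Ribbon graphs -/

/-- The corners of the edge discs. The disc of the edge `e` meets the vertex discs in two arcs
`(e, false)` and `(e, true)`, its two ends; the arc `(e, b)` has the two end points
`(e, b, false)` and `(e, b, true)`. The rest of the boundary of the disc `e` consists of two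
sides, the side `s` running from `(e, false, s)` to `(e, true, s)`. -/
abbrev Corner (E : Type*) : Type _ := E × Bool × Bool

namespace Corner

variable {E : Type*}

/-- The other end point of the same arc. -/
def acrossArc (c : Corner E) : Corner E := (c.1, c.2.1, !c.2.2)

/-- The other end point of the same side of the edge disc. -/
def alongSide (c : Corner E) : Corner E := (c.1, !c.2.1, c.2.2)

end Corner

/-- A ribbon graph with vertex set `V` and edge set `E` (up to homeomorphism), given by the way in
which the edge discs are glued to the vertex discs. The arc `(e, b)` lies on the boundary circle of
the vertex `vertexAt e b`. The points `c : Corner E` cut the vertex circles that carry arcs into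
the arcs and, alternating with them, the free segments; `next c` is the other end point of the free
segment that starts at `c`. The last field says that the arcs and free segments at one vertex form
a single circle. Vertices without arcs are isolated discs. -/
structure RibbonGraph (V E : Type*) where
  vertexAt : E → Bool → V
  next : Corner E → Corner E
  next_next : ∀ c, next (next c) = c
  next_ne : ∀ c, next c ≠ c
  vertexAt_next : ∀ c, vertexAt (next c).1 (next c).2.1 = vertexAt c.1 c.2.1
  one_circle : ∀ c d : Corner E, vertexAt c.1 c.2.1 = vertexAt d.1 d.2.1 →
    Relation.EqvGen (fun x y => y = next x ∨ y = x.acrossArc) c d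

namespace RibbonGraph

variable {V E : Type*} [DecidableEq E] (G : RibbonGraph V E)

/-- The connected components of `G`: the classes of vertices under the equivalence relation
generated by adjacency. -/
def Component : Type _ :=
  Quot fun u v : V => ∃ e, G.vertexAt e false = u ∧ G.vertexAt e true = v

/-- `k(G)`, the number of connected components. -/
noncomputable def numComponents : ℕ := Nat.card G.Component

/-- A vertex disc that meets no edge disc. -/
def IsIsolated (v : V) : Prop := ∀ e b, G.vertexAt e b ≠ v

/-- One step along the boundary of the spanning ribbon subgraph `(V, A)`: a point moves along its
free segment; and it moves along the side of its edge if the edge is in `A`, and along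
the arc, which is then part of the boundary, if the edge is not in `A`. -/
def BoundaryStep (A : Finset E) (c d : Corner E) : Prop :=
  d = G.next c ∨ d = if c.1 ∈ A then c.alongSide else c.acrossArc

/-- The boundary components of the spanning ribbon subgraph `(V, A)`: the closed curves through
corner points, and one circle for each isolated vertex disc of `G`. -/
def BoundaryComponent (A : Finset E) : Type _ :=
  Quot (G.BoundaryStep A) ⊕ {v : V // G.IsIsolated v}

/-- The component of `G` that contains a corner point. -/
def cornerComponent (c : Corner E) : G.Component := Quot.mk _ (G.vertexAt c.1 c.2.1)

theorem cornerComponent_eq_of_boundaryStep (A : Finset E) (c d : Corner E)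
    (h : G.BoundaryStep A c d) : G.cornerComponent c = G.cornerComponent d := by
  rcases h with rfl | rfl
  · unfold cornerComponent
    rw [G.vertexAt_next]
  · obtain ⟨e, b, s⟩ := c
    have h : G.cornerComponent (e, false, s) = G.cornerComponent (e, true, s) :=
      Quot.sound ⟨e, rfl, rfl⟩
    by_cases he : e ∈ A
    · cases b <;> simp [he, Corner.alongSide, h]
    · rw [if_neg he]; rfl

/-- The component of `G` in which a boundary component of `(V, A)` lies. -/
def boundaryLocation (A : Finset E) : G.BoundaryComponent A → G.Component :=
  Sum.elim (Quot.lift G.cornerComponent (G.cornerComponent_eq_of_boundaryStep A))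
    (fun v => Quot.mk _ v.1)

/-- `f(G)`, the number of boundary components of `G`. -/
noncomputable def numBoundary [Fintype E] : ℕ := Nat.card (G.BoundaryComponent Finset.univ)

/-- The delta-matroid `D(G)`: a set `A` is feasible if the spanning ribbon subgraph `(V, A)`
restricts to a quasi-tree, that is, has exactly one boundary component, in each connected
component of `G`. -/
def deltaMatroid : SetSystem E :=
  ⟨{A | ∀ K : G.Component, ∃! b : G.BoundaryComponent A, G.boundaryLocation A b = K}⟩

/-- Exchange the two end points of the arc `(e, true)` for every `e ∈ A`. -/
def reverseArcs (A : Finset E) (c : Corner E) : Corner E :=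
  if c.1 ∈ A ∧ c.2.1 = true then c.acrossArc else c

theorem reverseArcs_fst (A : Finset E) (c : Corner E) : (reverseArcs A c).1 = c.1 := by
  unfold reverseArcs; split_ifs <;> rfl

theorem reverseArcs_snd_fst (A : Finset E) (c : Corner E) :
    (reverseArcs A c).2.1 = c.2.1 := by
  unfold reverseArcs; split_ifs <;> rfl

theorem reverseArcs_reverseArcs (A : Finset E) (c : Corner E) :
    reverseArcs A (reverseArcs A c) = c := by
  obtain ⟨e, b, s⟩ := c
  by_cases h : e ∈ A ∧ b = true <;> simp [reverseArcs, Corner.acrossArc, h]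

theorem reverseArcs_acrossArc (A : Finset E) (c : Corner E) :
    reverseArcs A c.acrossArc = (reverseArcs A c).acrossArc := by
  obtain ⟨e, b, s⟩ := c
  by_cases h : e ∈ A ∧ b = true <;> simp [reverseArcs, Corner.acrossArc, h]

/-- The partial Petrial `G^{τ(A)}`: every edge `e ∈ A` is detached from its vertex along the arc
`(e, true)` and glued back with that arc reversed. -/
def petrial (A : Finset E) : RibbonGraph V E where
  vertexAt := G.vertexAt
  next c := reverseArcs A (G.next (reverseArcs A c))
  next_next c := by simp only [reverseArcs_reverseArcs, G.next_next]
  next_ne c h := by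
    apply G.next_ne (reverseArcs A c)
    rw [← reverseArcs_reverseArcs A (G.next _), h]
  vertexAt_next c := by
    simp only [reverseArcs_fst, reverseArcs_snd_fst, G.vertexAt_next]
  one_circle c d h := by
    have key : ∀ x y : Corner E,
        Relation.EqvGen (fun x y => y = G.next x ∨ y = x.acrossArc) x y →
        Relation.EqvGen (fun x y => y = reverseArcs A (G.next (reverseArcs A x)) ∨
          y = x.acrossArc) (reverseArcs A x) (reverseArcs A y) := by
      intro x y hxy
      induction hxy with
      | rel x y hxy =>
        apply Relation.EqvGen.rel
        rcases hxy with rfl | rfl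
        · left; rw [reverseArcs_reverseArcs]
        · right; rw [reverseArcs_acrossArc]
      | refl x => exact Relation.EqvGen.refl _
      | symm x y _ ih => exact Relation.EqvGen.symm _ _ ih
      | trans x y z _ _ ih₁ ih₂ => exact Relation.EqvGen.trans _ _ _ ih₁ ih₂
    have := key (reverseArcs A c) (reverseArcs A d)
      (G.one_circle _ _ (by simpa only [reverseArcs_fst, reverseArcs_snd_fst] using h))
    simpa only [reverseArcs_reverseArcs] using this

/-- The Penrose polynomial `∑_{A ⊆ E} (-1)^|A| λ^{f(G^{τ(A)})}` of a ribbon graph. -/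
noncomputable def penrose [Fintype E] : ℤ[X] :=
  ∑ A : Finset E, (-1) ^ A.card * X ^ (G.petrial A).numBoundary

end RibbonGraph

/-! Boundary curves are circuits of a transition system: free segments, alternating at each edge
with one of the three perfect matchings of its four corners (arcs, sides, diagonals). With
everything else fixed, exactly one matching at an edge leaves its corners on two circuits; each of
the other two unites these circuits (`exists_not_joined`).

Label each edge with two distinct matchings, the second used on `A` and the first elsewhere, and
call `A` feasible if the state is `Spanning`. `D(G)` arises from the labels (arc, side). Twisting
swaps labels; loop complementation replaces the second label by the third matching, because zero or
two of the three matchings at an edge give spanning states. Hence this class of set systems is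
closed under both operations, and each member is a delta-matroid, which gives vf-safety.

In such a system the minimum feasible size is the number of circuits lost between the state of `∅`
and a spanning state (`card_circuits_eq`). For `D * E ∗̄ A` the state of `∅` traces the boundary of
`G^{τ(A)}`, so `f(G^{τ(A)}) = k(G) + d`, and the polynomials agree term by term. -/

/-! ### Orbits of two involutions -/

/-- In an orbit of two involutions, the first of which has no fixed point, a fixed point of the
second one is accompanied by exactly one further fixed point. -/
theorem exists_unique_other_fixedPoint {α : Type*} [Finite α] {n m : α → α}
    (hn : Function.Involutive n) (hn' : ∀ c, n c ≠ c) (hm : Function.Involutive m)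
    {a : α} (ha : m a = a) :
    ∃ b, b ≠ a ∧ m b = b ∧ Relation.EqvGen (fun c d => d = n c ∨ d = m c) a b ∧
      ∀ c, m c = c → Relation.EqvGen (fun c d => d = n c ∨ d = m c) a c → c = a ∨ c = b := by
  -- The orbit of `a` is a single cycle of `g = n ∘ m`, on which `m` and `n` act as the reflections
  -- `i ↦ -i` and `i ↦ 1 - i`.
  let g : Equiv.Perm α := hm.toPerm.trans hn.toPerm
  have hg : ∀ c, g c = n (m c) := fun _ => rfl
  have hg' : ∀ c, g⁻¹ c = m (n c) := fun _ => rfl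
  have hmz : ∀ i : ℤ, m ((g ^ i) a) = (g ^ (-i)) a := by
    intro i
    induction i using Int.induction_on with
    | zero => simpa using ha
    | succ i ih =>
      rw [show (i : ℤ) + 1 = 1 + i by ring, zpow_add, zpow_one, Equiv.Perm.mul_apply, hg, ih,
        show -(1 + (i : ℤ)) = -1 + -i by ring, zpow_add, zpow_neg_one, Equiv.Perm.mul_apply, hg']
    | pred i ih =>
      rw [show -(i : ℤ) - 1 = -1 + -i by ring, zpow_add, zpow_neg_one, Equiv.Perm.mul_apply, hg',
        hm, show -(-1 + -(i : ℤ)) = 1 + - -i by ring, zpow_add, zpow_one, Equiv.Perm.mul_apply,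
        hg, ← ih, hm]
  have hnz : ∀ i : ℤ, n ((g ^ i) a) = (g ^ (1 - i)) a := by
    intro i
    rw [show 1 - i = 1 + -i by ring, zpow_add, zpow_one, Equiv.Perm.mul_apply, hg, ← hmz, hm]
  obtain ⟨N, hN0, hN⟩ : ∃ N : ℤ, 0 < N ∧ ∀ i : ℤ, (g ^ i) a = a ↔ N ∣ i := by
    refine ⟨Function.minimalPeriod (g • ·) a, ?_, fun i => ?_⟩
    · exact_mod_cast Function.minimalPeriod_pos_of_mem_periodicPts
        (Function.Injective.mem_periodicPts (f := (g • ·)) g.injective a)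
    · exact MulAction.zpow_smul_eq_iff_minimalPeriod_dvd (a := g) (b := a)
  have hN2 : ∀ i j : ℤ, (g ^ i) a = (g ^ j) a ↔ N ∣ i - j := by
    intro i j
    rw [← hN, sub_eq_neg_add, zpow_add, Equiv.Perm.mul_apply, zpow_neg, Equiv.Perm.inv_eq_iff_eq]
  -- An odd period `2k + 1` would make `g^(k+1) a` a fixed point of `n`. For `N = 2k` the fixed
  -- points of `m` are the `g^i a` with `k ∣ i`, that is, `a` and `g^k a`.
  obtain ⟨k, hk⟩ | ⟨k, hk⟩ := Int.even_or_odd N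
  swap
  · exact absurd ((hnz (k + 1)).trans ((hN2 _ _).2 ⟨-1, by rw [hk]; ring⟩)) (hn' _)
  have hrel : ∀ i : ℤ, Relation.EqvGen (fun c d => d = n c ∨ d = m c) a ((g ^ i) a) := by
    intro i
    induction i using Int.induction_on with
    | zero => exact Relation.EqvGen.refl _
    | succ i ih =>
      rw [show (i : ℤ) + 1 = 1 + i by ring, zpow_add, zpow_one, Equiv.Perm.mul_apply, hg]
      exact (ih.trans _ _ _ (.rel _ _ (.inr rfl))).trans _ _ _ (.rel _ _ (.inl rfl))
    | pred i ih =>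
      rw [show -(i : ℤ) - 1 = -1 + -i by ring, zpow_add, zpow_neg_one, Equiv.Perm.mul_apply, hg']
      exact (ih.trans _ _ _ (.rel _ _ (.inl rfl))).trans _ _ _ (.rel _ _ (.inr rfl))
  have horb : ∀ c d, Relation.EqvGen (fun c d => d = n c ∨ d = m c) c d →
      ((∃ i : ℤ, c = (g ^ i) a) ↔ ∃ i : ℤ, d = (g ^ i) a) := by
    intro c d h
    induction h with
    | rel c d h =>
      rcases h with rfl | rfl
      · exact ⟨fun ⟨i, hi⟩ => ⟨_, by rw [hi, hnz]⟩, fun ⟨i, hi⟩ => ⟨_, by rw [← hn c, hi, hnz]⟩⟩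
      · exact ⟨fun ⟨i, hi⟩ => ⟨_, by rw [hi, hmz]⟩, fun ⟨i, hi⟩ => ⟨_, by rw [← hm c, hi, hmz]⟩⟩
    | refl => rfl
    | symm _ _ _ ih => exact ih.symm
    | trans _ _ _ _ _ ih₁ ih₂ => exact ih₁.trans ih₂
  refine ⟨(g ^ k) a, ?_, ?_, hrel k, ?_⟩
  · rw [Ne, hN]
    rintro ⟨q, hq⟩
    have : k * (1 - 2 * q) = 0 := by linear_combination hq + q * hk
    rcases mul_eq_zero.1 this with h | h <;> omega
  · rw [hmz, hN2]
    exact ⟨-1, by rw [hk]; ring⟩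
  · intro c hc hac
    obtain ⟨i, rfl⟩ := (horb _ _ hac).1 ⟨0, rfl⟩
    rw [hmz, hN2] at hc
    obtain ⟨q, hq⟩ := hc
    have hi : i = -(k * q) := by
      rw [hk] at hq
      linarith
    obtain ⟨r, hr⟩ | ⟨r, hr⟩ := Int.even_or_odd q
    · exact .inl ((hN _).2 ⟨-r, by rw [hi, hk, hr]; ring⟩)
    · exact .inr ((hN2 _ _).2 ⟨-r - 1, by rw [hi, hk, hr]; ring⟩)

/-! ### Merging two classes of an equivalence relation -/

namespace Setoid

variable {α : Type*}

/-- `s` arises from `r` by uniting two distinct classes. -/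
def Merges (r s : Setoid α) : Prop :=
  r ≤ s ∧ ∃ a b, s a b ∧ ¬ r a b ∧ ∀ c d, s c d → r c d ∨ (r c a ∧ r d b) ∨ (r c b ∧ r d a)

/-- Any pair that `u` adds to `r` links the classes of `a` and `b`, and this link already generates
`s`. -/
theorem Merges.eq_of_le {r s u : Setoid α} (h : Merges r s) (hru : r ≤ u) (hus : u ≤ s)
    (hne : ¬ u ≤ r) : u = s := by
  obtain ⟨-, a, b, hab, hab', H⟩ := h
  refine le_antisymm hus ?_
  have huab : u a b := by
    by_contra hu
    refine hne fun c d hcd => ?_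
    rcases H c d (hus hcd) with h | ⟨h₁, h₂⟩ | ⟨h₁, h₂⟩
    · exact h
    · exact absurd (u.trans (u.symm (hru h₁)) (u.trans hcd (hru h₂))) hu
    · exact absurd (u.trans (u.symm (hru h₂)) (u.trans (u.symm hcd) (hru h₁))) hu
  intro c d hcd
  rcases H c d hcd with h | ⟨h₁, h₂⟩ | ⟨h₁, h₂⟩
  · exact hru h
  · exact u.trans (hru h₁) (u.trans huab (u.symm (hru h₂)))
  · exact u.trans (hru h₁) (u.trans (u.symm huab) (u.symm (hru h₂)))

theorem Merges.card_quotient [Finite α] {r s : Setoid α} (h : Merges r s) :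
    Nat.card (Quotient r) = Nat.card (Quotient s) + 1 := by
  classical
  obtain ⟨hrs, a, b, hab, hab', H⟩ := h
  -- The class of `b` goes to `none`, so the class of `a` alone represents the united class.
  let f : Quotient r → Option (Quotient s) := Quotient.lift
    (fun c => if r c b then none else some (Quotient.mk s c)) (by
      intro c d hcd
      have hcd : r c d := hcd
      have : r c b ↔ r d b := ⟨r.trans (r.symm hcd), r.trans hcd⟩
      by_cases hc : r c b
      · simp [hc, this.1 hc]
      · have hd : ¬ r d b := fun h => hc (this.2 h)
        simp only [hc, hd, if_false, Option.some.injEq]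
        exact Quotient.sound (hrs hcd))
  have hf : ∀ c, f (Quotient.mk r c) = if r c b then none else some (Quotient.mk s c) :=
    fun _ => rfl
  rw [← Finite.card_option]
  refine Nat.card_congr (Equiv.ofBijective f ⟨?_, ?_⟩)
  · intro x y
    induction x using Quotient.inductionOn with | _ c
    induction y using Quotient.inductionOn with | _ d
    rw [hf, hf]
    intro h
    apply Quotient.sound
    change r c d
    by_cases hc : r c b <;> by_cases hd : r d b <;> simp [hc, hd] at h
    · exact r.trans hc (r.symm hd)
    · rcases H c d (Quotient.exact h) with h | ⟨-, h⟩ | ⟨h, -⟩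
      · exact h
      · exact absurd h hd
      · exact absurd h hc
  · intro y
    cases y with
    | none => exact ⟨Quotient.mk r b, by rw [hf, if_pos (r.refl b)]⟩
    | some y =>
      induction y using Quotient.inductionOn with | _ c
      by_cases hc : r c b
      · exact ⟨Quotient.mk r a, by
          rw [hf, if_neg hab']
          exact congrArg some (Quotient.sound (s.trans hab (s.symm (hrs hc))))⟩
      · exact ⟨Quotient.mk r c, by rw [hf, if_neg hc]⟩

theorem card_quotient_le_of_le [Finite α] {r s : Setoid α} (h : r ≤ s) :
    Nat.card (Quotient s) ≤ Nat.card (Quotient r) :=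
  Nat.card_le_card_of_surjective
    (Quotient.lift (fun c => Quotient.mk s c) fun _ _ hcd => Quotient.sound (h hcd)) fun y => by
      induction y using Quotient.inductionOn with | _ c
      exact ⟨Quotient.mk r c, rfl⟩

end Setoid

/-! ### Transition systems and their circuits -/

/-- The transitions at an edge disc: the translations of its four corners by an element of
`(ℤ/2)²`. The nonzero ones are the three perfect matchings of the corners. -/
abbrev Transition : Type := Bool × Bool

namespace Transition

/-- The sum in `(ℤ/2)²`. -/
def add (p q : Transition) : Transition := (xor p.1 q.1, xor p.2 q.2)

/-- The transition that fixes every corner. -/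
abbrev zero : Transition := (false, false)

/-- The transition along the arcs. -/
abbrev arc : Transition := (false, true)

/-- The transition along the sides. -/
abbrev side : Transition := (true, false)

/-- The transition along the diagonals. -/
abbrev diagonal : Transition := (true, true)

theorem add_zero : ∀ p : Transition, p.add zero = p := by decide

theorem add_add_cancel : ∀ p q : Transition, (p.add q).add q = p := by decide

theorem eq_zero_of_add_eq : ∀ p q : Transition, p.add q = p → q = zero := by decide

/-- A fixed point free involution of the four corners is a translation. -/
theorem exists_eq_add (f : Transition → Transition) (h : ∀ x, f x ≠ x) (h' : ∀ x, f (f x) = x) :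
    ∃ p, p ≠ zero ∧ ∀ x, f x = x.add p := by
  refine ⟨f zero, h zero, ?_⟩
  have a := h' (false, false)
  have b := h' (false, true)
  have c := h' (true, false)
  have d := h' (true, true)
  have a' := h (false, false)
  have b' := h (false, true)
  have c' := h (true, false)
  have d' := h (true, true)
  generalize hA : f (false, false) = A at *
  generalize hB : f (false, true) = B at *
  generalize hC : f (true, false) = C at *
  generalize hD : f (true, true) = D at *
  obtain ⟨_ | _, _ | _⟩ := A <;> obtain ⟨_ | _, _ | _⟩ := B <;>
    obtain ⟨_ | _, _ | _⟩ := C <;> obtain ⟨_ | _, _ | _⟩ := D <;>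
    simp_all [add]

theorem eq_or_eq_of_ne : ∀ p q x y : Transition, p ≠ zero → q ≠ zero → q ≠ p →
    y = x ∨ y = x.add p ∨ y = x.add q ∨ y = (x.add q).add p := by decide

end Transition

/-- The point opposite to a corner in a transition. -/
def Corner.shift {E : Type*} (p : Transition) (c : Corner E) : Corner E := (c.1, Transition.add c.2 p)

namespace Transition

variable {E : Type*} (n : Corner E → Corner E)

/-- The relation of lying on the same circuit, when the free segments are given by `n` and
the transition at the edge `e` is `t e`. -/
def circuit (t : E → Transition) : Setoid (Corner E) :=
  Relation.EqvGen.setoid fun c d => d = n c ∨ d = c.shift (t c.1)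

variable {n}

theorem circuit_next (t : E → Transition) (c : Corner E) : circuit n t c (n c) :=
  .rel _ _ (.inl rfl)

theorem circuit_shift (t : E → Transition) (c : Corner E) : circuit n t c (c.shift (t c.1)) :=
  .rel _ _ (.inr rfl)

theorem circuit_le {t : E → Transition} {r : Setoid (Corner E)} (h : ∀ c, r c (n c))
    (h' : ∀ c, r c (c.shift (t c.1))) : circuit n t ≤ r :=
  Setoid.eqvGen_le (by rintro c d (rfl | rfl) <;> [exact h c; exact h' c])

theorem card_quotient_circuit (n : Corner E → Corner E) (t : E → Transition) :
    Nat.card (Quotient (circuit n t)) =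
      Nat.card (Quot fun c d : Corner E => d = n c ∨ d = c.shift (t c.1)) :=
  Nat.card_congr
    { toFun := Quotient.lift (Quot.mk _) fun _ _ h => Quot.eqvGen_sound h
      invFun := Quot.lift (Quotient.mk _) fun _ _ h => Quotient.sound (.rel _ _ h)
      left_inv := fun x => by induction x using Quotient.inductionOn; rfl
      right_inv := fun x => by induction x using Quot.inductionOn; rfl }

variable (n) in
/-- The four corners of `e` lie on the same circuit. -/
def Joined (t : E → Transition) (e : E) : Prop := ∀ x y, circuit n t (e, x) (e, y)

variable (n) in
/-- There is only one circuit in each connected component. -/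
def Spanning (t : E → Transition) : Prop := ∀ e, Joined n t e

/-- A changed transition only connects corners of its own edge, and `t'` has these connected
already. -/
theorem circuit_le_circuit {t t' : E → Transition} (h : ∀ e, t e ≠ t' e → Joined n t' e) :
    circuit n t ≤ circuit n t' := by
  refine circuit_le (circuit_next _) fun c => ?_
  by_cases hc : t c.1 = t' c.1
  · rw [hc]
    exact circuit_shift _ _
  · exact h _ hc _ _

theorem Spanning.circuit_le {t t' : E → Transition} (h : Spanning n t') :
    circuit n t ≤ circuit n t' :=
  circuit_le_circuit fun e _ => h e

theorem Spanning.of_le {t t' : E → Transition} (h : Spanning n t)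
    (hle : circuit n t ≤ circuit n t') : Spanning n t' :=
  fun e x y => hle (h e x y)

/-- Circuits of spanning systems do not depend on the transitions, so any one of them can be used
for counting components. -/
theorem Spanning.circuit_eq {t t' : E → Transition} (h : Spanning n t) (h' : Spanning n t') :
    circuit n t = circuit n t' :=
  le_antisymm h'.circuit_le h.circuit_le

variable [DecidableEq E] {t : E → Transition}


/-- The segments left over when the corners of `e` are cut free pair up these corners. -/
theorem exists_pairing [Finite E] (hn : Function.Involutive n) (hn' : ∀ c, n c ≠ c) (ht : ∀ f, t f ≠ zero)
    (e : E) : ∃ p, p ≠ zero ∧ ∀ x y : Transition,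
      circuit n (Function.update t e zero) (e, x) (e, y) ↔ y = x ∨ y = x.add p := by
  set t' := Function.update t e zero with ht'
  have hm : Function.Involutive fun c : Corner E => c.shift (t' c.1) := by
    intro c
    simp [Corner.shift, add_add_cancel]
  have hfix : ∀ x : Transition, Corner.shift (t' e) ((e, x) : Corner E) = (e, x) := by
    intro x
    simp [Corner.shift, ht', add_zero]
  -- The fixed points of the shift by `t'` are exactly the corners of `e`, as `t` is nonzero at all
  -- other edges.
  have key := fun x : Transition => exists_unique_other_fixedPoint hn hn' hm (hfix x)
  have key' : ∀ x : Transition, ∃ y : Transition, y ≠ x ∧ circuit n t' (e, x) (e, y) ∧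
      ∀ z : Transition, circuit n t' (e, x) (e, z) → z = x ∨ z = y := by
    intro x
    obtain ⟨⟨f, y⟩, hb, hfb, hr, hu⟩ := key x
    obtain rfl : f = e := by
      by_contra hf
      have := eq_zero_of_add_eq _ _ (congrArg Prod.snd hfb)
      simp only [ht', Function.update_of_ne hf] at this
      exact ht f this
    refine ⟨y, fun h => hb (by rw [h]), hr, fun z hz => ?_⟩
    rcases hu _ (hfix z) hz with h | h
    · exact .inl (congrArg Prod.snd h)
    · exact .inr (congrArg Prod.snd h)
  choose f hf hfr hfu using key'
  have hff : ∀ x, f (f x) = x := fun x =>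
    ((hfu (f x) x (Setoid.symm' _ (hfr x))).resolve_left (hf x).symm).symm
  obtain ⟨p, hp, hfp⟩ := exists_eq_add f hf hff
  refine ⟨p, hp, fun x y => ⟨fun h => hfp x ▸ hfu x y h, ?_⟩⟩
  rintro (rfl | rfl)
  · exact Setoid.refl' _ _
  · exact hfp x ▸ hfr x

theorem circuit_update_zero_le (t : E → Transition) (e : E) (q : Transition) :
    circuit n (Function.update t e zero) ≤ circuit n (Function.update t e q) := by
  refine circuit_le (circuit_next _) fun c => ?_
  by_cases hc : c.1 = e
  · have : c.shift zero = c := Prod.ext rfl (add_zero _)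
    rw [hc, Function.update_self, this]
  · rw [Function.update_of_ne hc, ← Function.update_of_ne hc q t]
    exact circuit_shift _ _

/-- Exactly one of the three transitions at `e` fails to put the corners of `e` on one circuit,
and replacing it by another one unites two circuits. -/
theorem exists_not_joined [Finite E] (hn : Function.Involutive n) (hn' : ∀ c, n c ≠ c)
    (ht : ∀ f, t f ≠ zero) (e : E) : ∃ p, p ≠ zero ∧ ¬ Joined n (Function.update t e p) e ∧
      ∀ q, q ≠ zero → q ≠ p → Joined n (Function.update t e q) e ∧
        (circuit n (Function.update t e p)).Merges (circuit n (Function.update t e q)) := by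
  obtain ⟨p, hp, H⟩ := exists_pairing hn hn' ht e
  have hle := circuit_update_zero_le (n := n) t e
  -- Closing up along `p` connects only corners that the leftover segments already connect.
  have hp0 : circuit n (Function.update t e p) = circuit n (Function.update t e zero) := by
    refine le_antisymm (circuit_le (circuit_next _) fun c => ?_) (hle p)
    obtain ⟨f, x⟩ := c
    by_cases hf : f = e
    · subst hf
      rw [Function.update_self]
      exact (H _ _).2 (.inr rfl)
    · dsimp only
      rw [Function.update_of_ne hf, ← Function.update_of_ne hf zero t]
      exact circuit_shift (Function.update t e zero) (f, x)
  refine ⟨p, hp, fun h => ?_, fun q hq hqp => ?_⟩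
  · have := (H zero (if p = arc then side else arc)).1 (hp0 ▸ h _ _)
    clear * - hp this
    revert p
    decide
  have hq' : ∀ x : Transition, circuit n (Function.update t e q) (e, x) (e, x.add q) := by
    intro x
    have := circuit_shift (n := n) (Function.update t e q) (e, x)
    rwa [Function.update_self] at this
  have hJ : Joined n (Function.update t e q) e := by
    intro x y
    rcases eq_or_eq_of_ne p q x y hp hq hqp with rfl | rfl | rfl | rfl
    · exact Setoid.refl' _ _
    · exact hle q ((H _ _).2 (.inr rfl))
    · exact hq' x
    · exact Setoid.trans' _ (hq' x) (hle q ((H _ _).2 (.inr rfl)))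
  refine ⟨hJ, hp0 ▸ hle q, (e, zero), (e, q), hJ _ _, fun h => ?_, ?_⟩
  · rw [hp0, H] at h
    clear * - hq hqp h
    revert p q
    decide
  · rw [hp0]
    set r := circuit n (Function.update t e zero)
    have hr : ∀ x : Transition, r (e, x) (e, zero) ∨ r (e, x) (e, q) := by
      intro x
      rw [H, H]
      clear * - hp hq hqp
      revert p q x
      decide
    -- `r` with the classes of `(e, zero)` and `(e, q)` united; by `hr` every corner of `e` lies in
    -- one of the two.
    let s : Setoid (Corner E) :=
      { r := fun c d => r c d ∨ ((r c (e, zero) ∨ r c (e, q)) ∧ (r d (e, zero) ∨ r d (e, q)))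
        iseqv := by
          have st : ∀ {c d z}, r c d → r c z → r d z := fun h h' => r.trans (r.symm h) h'
          refine ⟨fun c => .inl (r.refl c), ?_, ?_⟩
          · rintro c d (h | h)
            · exact .inl (r.symm h)
            · exact .inr h.symm
          · rintro c d z (h | ⟨h₁, h₂⟩) (h' | ⟨h₁', h₂'⟩)
            · exact .inl (r.trans h h')
            · exact .inr ⟨h₁'.imp (r.trans h) (r.trans h), h₂'⟩
            · exact .inr ⟨h₁, h₂.imp (st h') (st h')⟩
            · exact .inr ⟨h₁, h₂'⟩ }
    have hs : circuit n (Function.update t e q) ≤ s := by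
      refine circuit_le (fun c => .inl (circuit_next _ c)) fun c => ?_
      obtain ⟨f, x⟩ := c
      by_cases hf : f = e
      · subst hf
        exact .inr ⟨hr _, hr _⟩
      · refine .inl ?_
        dsimp only
        rw [Function.update_of_ne hf, ← Function.update_of_ne hf zero t]
        exact circuit_shift (Function.update t e zero) (f, x)
    intro c d hcd
    rcases hs hcd with h | ⟨h₁ | h₁, h₂ | h₂⟩
    · exact .inl h
    · exact .inl (r.trans h₁ (r.symm h₂))
    · exact .inr (.inl ⟨h₁, h₂⟩)
    · exact .inr (.inr ⟨h₁, h₂⟩)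
    · exact .inl (r.trans h₁ (r.symm h₂))

/-- If `e` is not joined, its present transition is the exceptional one of `exists_not_joined`. -/
theorem joined_update_and_merges [Finite E] (hn : Function.Involutive n) (hn' : ∀ c, n c ≠ c)
    (ht : ∀ f, t f ≠ zero) {e : E} (he : ¬ Joined n t e) {q : Transition} (hq : q ≠ zero)
    (hqe : q ≠ t e) : Joined n (Function.update t e q) e ∧
      (circuit n t).Merges (circuit n (Function.update t e q)) := by
  obtain ⟨p, -, -, H⟩ := exists_not_joined hn hn' ht e
  obtain rfl : t e = p := by
    by_contra h
    have := (H (t e) (ht e) h).1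
    rw [Function.update_eq_self] at this
    exact he this
  simpa only [Function.update_eq_self] using H q hq hqe

theorem spanning_update_iff (t : E → Transition) {e : E} {p q : Transition}
    (hp : Joined n (Function.update t e p) e) (hq : Joined n (Function.update t e q) e) :
    Spanning n (Function.update t e p) ↔ Spanning n (Function.update t e q) := by
  have key : ∀ {p q : Transition}, Joined n (Function.update t e q) e →
      circuit n (Function.update t e p) ≤ circuit n (Function.update t e q) := by
    intro p q hq
    refine circuit_le_circuit fun f hf => ?_
    by_cases hfe : f = e
    · exact hfe ▸ hq
    · simp [hfe] at hf
  exact ⟨fun h => h.of_le (key hq), fun h => h.of_le (key hp)⟩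

/-- Of the three transitions at `e`, none or two give a spanning transition system. -/
theorem spanning_update_add [Finite E] (hn : Function.Involutive n) (hn' : ∀ c, n c ≠ c)
    (ht : ∀ f, t f ≠ zero) (e : E) {p q : Transition} (hp : p ≠ zero) (hq : q ≠ zero)
    (hpq : p ≠ q) : Spanning n (Function.update t e (p.add q)) ↔
      Xor (Spanning n (Function.update t e q)) (Spanning n (Function.update t e p)) := by
  obtain ⟨o, ho, hJ, H⟩ := exists_not_joined hn hn' ht e
  have hS : ¬ Spanning n (Function.update t e o) := fun h => hJ (h e)
  -- The three matchings are `p`, `q` and `p + q`. The exceptional one `o` is never spanning, and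
  -- the other two are spanning together or not at all.
  have hpq0 : p.add q ≠ zero ∧ p.add q ≠ p ∧ p.add q ≠ q ∧ (o = p ∨ o = q ∨ o = p.add q) := by
    clear * - hp hq hpq ho
    revert p q o
    decide
  obtain ⟨h0, h1, h2, rfl | rfl | rfl⟩ := hpq0
  · have := spanning_update_iff t (H q hq hpq.symm).1 (H _ h0 h1).1
    simp [Xor, hS, this]
  · have := spanning_update_iff t (H p hp hpq).1 (H _ h0 h2).1
    simp [Xor, hS, this]
  · have := spanning_update_iff t (H p hp h1.symm).1 (H q hq h2.symm).1
    simp [Xor, hS, this]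

end Transition

/-! ### The set system of a labelled transition system -/

namespace Transition

variable {E : Type*} [DecidableEq E] {n : Corner E → Corner E} {σ : E → Transition × Transition}

/-- The two chosen transitions at every edge are distinct perfect matchings. -/
def IsLabelling (σ : E → Transition × Transition) : Prop :=
  ∀ e, (σ e).1 ≠ zero ∧ (σ e).2 ≠ zero ∧ (σ e).1 ≠ (σ e).2

/-- The transition system given by the second label on `A` and the first one elsewhere. -/
def state (σ : E → Transition × Transition) (A : Finset E) (e : E) : Transition :=
  if e ∈ A then (σ e).2 else (σ e).1

theorem IsLabelling.state_ne_zero (h : IsLabelling σ) (A : Finset E) (e : E) :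
    state σ A e ≠ zero := by
  unfold state
  split_ifs
  exacts [(h e).2.1, (h e).1]

theorem state_insert (σ : E → Transition × Transition) (A : Finset E) (e : E) :
    state σ (insert e A) = Function.update (state σ A) e (σ e).2 := by
  ext1 f
  by_cases hf : f = e
  · subst hf
    simp [state]
  · simp [state, hf]

theorem state_erase (σ : E → Transition × Transition) (A : Finset E) (e : E) :
    state σ (A.erase e) = Function.update (state σ A) e (σ e).1 := by
  ext1 f
  by_cases hf : f = e
  · subst hf
    simp [state]
  · simp [state, hf]

theorem exists_state_symmDiff_singleton (h : IsLabelling σ) (A : Finset E) (e : E) :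
    ∃ q, q ≠ zero ∧ q ≠ state σ A e ∧ state σ (A ∆ {e}) = Function.update (state σ A) e q := by
  by_cases he : e ∈ A
  · refine ⟨(σ e).1, (h e).1, by simpa [state, he] using (h e).2.2, ?_⟩
    rw [← state_erase]
    congr 1
    ext f
    by_cases hf : f = e <;> simp [Finset.mem_symmDiff, hf, he]
  · refine ⟨(σ e).2, (h e).2.1, by simpa [state, he] using (h e).2.2.symm, ?_⟩
    rw [← state_insert]
    congr 1
    ext f
    by_cases hf : f = e <;> simp [Finset.mem_symmDiff, hf, he]

variable (n) in
/-- The set system whose feasible sets are the `A` with `state σ A` spanning. -/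
def setSystem (σ : E → Transition × Transition) : SetSystem E :=
  ⟨{A | Spanning n (state σ A)}⟩

theorem mem_setSystem {A : Finset E} :
    A ∈ (setSystem n σ).feasible ↔ Spanning n (state σ A) := Iff.rfl

/-- Exchange the two labels on `A`. -/
def swapOn (A : Finset E) (σ : E → Transition × Transition) (e : E) : Transition × Transition :=
  if e ∈ A then (σ e).swap else σ e

/-- Replace the second label on `A` by the third transition. -/
def rotateOn (A : Finset E) (σ : E → Transition × Transition) (e : E) : Transition × Transition :=
  if e ∈ A then ((σ e).1, (σ e).1.add (σ e).2) else σ e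

theorem IsLabelling.swapOn (h : IsLabelling σ) (A : Finset E) : IsLabelling (swapOn A σ) := by
  intro e
  unfold Transition.swapOn
  split_ifs
  · exact ⟨(h e).2.1, (h e).1, (h e).2.2.symm⟩
  · exact h e

theorem IsLabelling.rotateOn (h : IsLabelling σ) (A : Finset E) : IsLabelling (rotateOn A σ) := by
  intro e
  unfold Transition.rotateOn
  split_ifs
  · obtain ⟨h₁, h₂, h₃⟩ := h e
    generalize σ e = p at *
    clear * - h₁ h₂ h₃
    revert p
    decide
  · exact h e

theorem twist_setSystem (A : Finset E) :
    (setSystem n σ).twist A = setSystem n (swapOn A σ) := by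
  have key : ∀ X, state (swapOn A σ) (A ∆ X) = state σ X := by
    intro X
    ext1 e
    by_cases h : e ∈ A <;> by_cases h' : e ∈ X <;>
      simp [state, swapOn, Finset.mem_symmDiff, h, h']
  ext F
  constructor
  · rintro ⟨X, hX, rfl⟩
    rw [mem_setSystem, key]
    exact hX
  · intro hF
    refine ⟨A ∆ F, ?_, (symmDiff_symmDiff_cancel_left A F).symm⟩
    rw [mem_setSystem, ← key, symmDiff_symmDiff_cancel_left]
    exact hF

variable [Finite E]

/-- For `e ∈ F` the new state has the third matching at `e`; by `spanning_update_add` it is spanning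
iff exactly one of `F` and `F.erase e` was feasible. -/
theorem loopComplElem_setSystem (hn : Function.Involutive n) (hn' : ∀ c, n c ≠ c)
    (h : IsLabelling σ) (e : E) :
    (setSystem n σ).loopComplElem e = setSystem n (rotateOn {e} σ) := by
  ext F
  rw [SetSystem.mem_loopComplElem, mem_setSystem, mem_setSystem, mem_setSystem, state_erase]
  by_cases he : e ∈ F
  · have h₁ : state (rotateOn {e} σ) F =
        Function.update (state σ F) e ((σ e).1.add (σ e).2) := by
      ext1 f
      by_cases hf : f = e
      · subst hf
        simp [state, rotateOn, he]
      · simp [state, rotateOn, hf]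
    have h₂ : Function.update (state σ F) e (σ e).2 = state σ F := by
      rw [← state_insert, Finset.insert_eq_of_mem he]
    rw [h₁, spanning_update_add hn hn' (h.state_ne_zero F) e (h e).1 (h e).2.1 (h e).2.2, h₂]
    simp [he]
  · have h₁ : state (rotateOn {e} σ) F = state σ F := by
      ext1 f
      by_cases hf : f = e
      · subst hf
        simp [state, rotateOn, he]
      · simp [state, rotateOn, hf]
    simp [h₁, he, Xor]

theorem loopCompl_setSystem (hn : Function.Involutive n) (hn' : ∀ c, n c ≠ c)
    (h : IsLabelling σ) (A : Finset E) :
    (setSystem n σ).loopCompl A = setSystem n (rotateOn A σ) := by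
  induction A using Finset.induction_on generalizing σ with
  | empty =>
    have : rotateOn ∅ σ = σ := by
      ext1 f
      simp [rotateOn]
    rw [this]
    rfl
  | insert e A he ih =>
    have h₁ : (setSystem n σ).loopCompl (insert e A) =
        ((setSystem n σ).loopComplElem e).loopCompl A := by
      rw [SetSystem.loopCompl, Finset.insert_val_of_notMem he, Multiset.foldl_cons]
      rfl
    rw [h₁, loopComplElem_setSystem hn hn' h, ih (h.rotateOn {e})]
    congr 1
    ext1 f
    by_cases hf : f = e
    · subst hf
      simp [rotateOn, he]
    · simp [rotateOn, hf]

/-- The set obtained from `∅` by adding edges that unite circuits until the state is spanning. -/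
theorem exists_spanning_state (hn : Function.Involutive n) (hn' : ∀ c, n c ≠ c)
    (h : IsLabelling σ) : ∃ A : Finset E, Spanning n (state σ A) ∧
      Nat.card (Quotient (circuit n (state σ ∅))) =
        Nat.card (Quotient (circuit n (state σ A))) + A.card := by
  classical
  have := Fintype.ofFinite E
  -- A maximal member of `S` is spanning: an edge not joined would lie outside it, and adding that
  -- edge unites two circuits.
  let S : Finset (Finset E) := Finset.univ.filter fun A => (∀ e ∈ A, Joined n (state σ A) e) ∧
    Nat.card (Quotient (circuit n (state σ ∅))) =
      Nat.card (Quotient (circuit n (state σ A))) + A.card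
  obtain ⟨A, hA, hmax⟩ := S.exists_max_image Finset.card ⟨∅, by simp [S]⟩
  simp only [S, Finset.mem_filter, Finset.mem_univ, true_and] at hA hmax
  refine ⟨A, fun e => ?_, hA.2⟩
  by_contra he
  have heA : e ∉ A := fun h => he (hA.1 e h)
  obtain ⟨hJ, hM⟩ := joined_update_and_merges hn hn' (h.state_ne_zero A) he (h e).2.1
    (by simpa [state, heA] using (h e).2.2.symm)
  rw [← state_insert] at hJ hM
  have := hmax (insert e A) ⟨fun f hf => ?_, ?_⟩
  · rw [Finset.card_insert_of_notMem heA] at this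
    omega
  · rcases Finset.mem_insert.1 hf with rfl | hf
    · exact hJ
    · exact fun x y => hM.1 (hA.1 f hf x y)
  · rw [hA.2, hM.card_quotient, Finset.card_insert_of_notMem heA]
    omega

/-- Changing the transition at one edge lowers the number of circuits by at most one. -/
theorem card_circuits_empty_le (hn : Function.Involutive n) (hn' : ∀ c, n c ≠ c)
    (h : IsLabelling σ) (A : Finset E) :
    Nat.card (Quotient (circuit n (state σ ∅))) ≤
      Nat.card (Quotient (circuit n (state σ A))) + A.card := by
  induction A using Finset.induction_on with
  | empty => simp
  | insert e A heA ih =>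
    rw [Finset.card_insert_of_notMem heA]
    by_cases he : Joined n (state σ A) e
    · have : circuit n (state σ (insert e A)) ≤ circuit n (state σ A) := by
        refine circuit_le_circuit fun f hf => ?_
        rw [state_insert] at hf
        by_cases hfe : f = e
        · exact hfe ▸ he
        · simp [hfe] at hf
      have := Setoid.card_quotient_le_of_le this
      omega
    · have := (joined_update_and_merges hn hn' (h.state_ne_zero A) he (h e).2.1
        (by simpa [state, heA] using (h e).2.2.symm)).2.card_quotient
      rw [← state_insert] at this
      omega

theorem isDeltaMatroid_setSystem (hn : Function.Involutive n) (hn' : ∀ c, n c ≠ c)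
    (h : IsLabelling σ) : (setSystem n σ).IsDeltaMatroid := by
  refine ⟨?_, fun X hX Y hY u hu => ?_⟩
  · obtain ⟨A, hA, -⟩ := exists_spanning_state hn hn' h
    exact ⟨A, hA⟩
  rw [mem_setSystem] at hX hY
  by_cases hXu : Spanning n (state σ (X ∆ {u}))
  · exact ⟨u, hu, by simpa [mem_setSystem] using hXu⟩
  have huJ : ¬ Joined n (state σ (X ∆ {u})) u := by
    intro hJ
    refine hXu (hX.of_le (circuit_le_circuit fun f hf => ?_))
    by_cases hfu : f = u
    · exact hfu ▸ hJ
    · simp [state, Finset.mem_symmDiff, hfu] at hf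
  -- The states of `X ∆ {u}` and `Y` agree at `u` and outside `X ∆ Y`. If all other edges of `X ∆ Y`
  -- were joined, the circuits of `Y` would refine those of `X ∆ {u}`, and `u` would be joined.
  obtain ⟨v, hv, hvJ⟩ : ∃ v ∈ X ∆ Y, v ≠ u ∧ ¬ Joined n (state σ (X ∆ {u})) v := by
    by_contra! H
    refine huJ fun x y => ?_
    refine circuit_le_circuit (t := state σ Y) (fun f hf => ?_) (hY u x y)
    have hfu : f ≠ u := by
      rintro rfl
      apply hf
      by_cases hfX : f ∈ X <;> by_cases hfY : f ∈ Y <;>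
        simp_all [state, Finset.mem_symmDiff]
    refine H f ?_ hfu
    by_contra hfXY
    apply hf
    by_cases hfX : f ∈ X <;> by_cases hfY : f ∈ Y <;>
      simp_all [state, Finset.mem_symmDiff]
  refine ⟨v, hv, ?_⟩
  have hXuv : X ∆ {u, v} = (X ∆ {u}) ∆ {v} := by
    ext f
    have := hvJ.1
    by_cases hfu : f = u <;> by_cases hfv : f = v <;>
      simp_all [Finset.mem_symmDiff]
  rw [mem_setSystem, hXuv]
  obtain ⟨q, hq, hqv, hs⟩ := exists_state_symmDiff_singleton h (X ∆ {u}) v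
  obtain ⟨q', hq', hqu', hs'⟩ := exists_state_symmDiff_singleton h (X ∆ {u}) u
  rw [symmDiff_symmDiff_cancel_right] at hs'
  have hM := (joined_update_and_merges hn hn' (h.state_ne_zero _) huJ hq' hqu').2
  obtain ⟨hJ, hM'⟩ := joined_update_and_merges hn hn' (h.state_ne_zero _) hvJ.2 hq hqv
  rw [← hs'] at hM
  rw [← hs] at hM' hJ
  -- The circuits of `X` arise from those of `X ∆ {u}` by one merge, and those of `X ∆ {u, v}` lie
  -- strictly above the latter and below the former, so they equal those of `X`.
  exact hX.of_le (hM.eq_of_le hM'.1 hX.circuit_le fun hle => hvJ.2 fun x y => hle (hJ x y)).ge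

theorem isVfSafe_setSystem (hn : Function.Involutive n) (hn' : ∀ c, n c ≠ c)
    (h : IsLabelling σ) : (setSystem n σ).IsVfSafe := by
  have key : ∀ D', (setSystem n σ).Reachable D' → ∃ σ', IsLabelling σ' ∧ D' = setSystem n σ' := by
    intro D' hD'
    induction hD' with
    | refl => exact ⟨σ, h, rfl⟩
    | twist A _ ih =>
      obtain ⟨σ', h', rfl⟩ := ih
      exact ⟨_, h'.swapOn A, twist_setSystem A⟩
    | loopCompl A _ ih =>
      obtain ⟨σ', h', rfl⟩ := ih
      exact ⟨_, h'.rotateOn A, loopCompl_setSystem hn hn' h' A⟩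
  intro D' hD'
  obtain ⟨σ', h', rfl⟩ := key D' hD'
  exact isDeltaMatroid_setSystem hn hn' h'

theorem dualPivot_twist_univ_setSystem [Fintype E] (hn : Function.Involutive n)
    (hn' : ∀ c, n c ≠ c) (h : IsLabelling σ) (A : Finset E) :
    ((setSystem n σ).twist Finset.univ).dualPivot A = setSystem n
      (swapOn A (rotateOn A (swapOn A (swapOn Finset.univ σ)))) := by
  rw [SetSystem.dualPivot, twist_setSystem, twist_setSystem,
    loopCompl_setSystem hn hn' ((h.swapOn _).swapOn _), twist_setSystem]

end Transition

theorem SetSystem.lowerRank_eq {E : Type*} [DecidableEq E] [Fintype E] (D : SetSystem E)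
    {A : Finset E} (hA : A ∈ D.feasible) (h : ∀ B ∈ D.feasible, A.card ≤ B.card) :
    D.lowerRank = A.card := by
  have : {k | ∃ B ∈ D.lower.feasible, k = (Finset.univ ∩ B).card} = {A.card} := by
    ext k
    simp only [Finset.univ_inter, Set.mem_ofPred_eq, Set.mem_singleton_iff]
    constructor
    · rintro ⟨B, ⟨hB, hB'⟩, rfl⟩
      exact le_antisymm (hB' A hA) (h B hB)
    · rintro rfl
      exact ⟨A, ⟨hA, h⟩, rfl⟩
  rw [lowerRank, rank, this, csSup_singleton]

namespace Transition

variable {E : Type*} [DecidableEq E] [Fintype E] {n : Corner E → Corner E}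
  {σ : E → Transition × Transition}

/-- The set from `exists_spanning_state` has minimum size among feasible sets, by
`card_circuits_empty_le`. -/
theorem card_circuits_eq (hn : Function.Involutive n) (hn' : ∀ c, n c ≠ c)
    (h : IsLabelling σ) {t : E → Transition} (ht : Spanning n t) :
    Nat.card (Quotient (circuit n (state σ ∅))) =
      Nat.card (Quotient (circuit n t)) + (setSystem n σ).lowerRank := by
  obtain ⟨A, hA, hc⟩ := exists_spanning_state hn hn' h
  rw [SetSystem.lowerRank_eq (setSystem n σ) hA, hc, hA.circuit_eq ht]
  intro B hB
  have := card_circuits_empty_le hn hn' h B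
  rw [hc, hA.circuit_eq ht, Spanning.circuit_eq hB ht] at this
  omega

end Transition

/-! ### Ribbon graphs -/

namespace RibbonGraph

open Transition

variable {V E : Type*}

/-- The labelling in which edges in the set follow their sides, the others their arcs. -/
def standardLabelling (_ : E) : Transition × Transition := (arc, side)

theorem isLabelling_standardLabelling : IsLabelling (standardLabelling (E := E)) := by
  intro e
  simp [standardLabelling]

variable [DecidableEq E] (G : RibbonGraph V E)

theorem boundaryStep_eq (A : Finset E) : G.BoundaryStep A = fun c d =>
    d = G.next c ∨ d = c.shift (state standardLabelling A c.1) := by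
  ext c d
  obtain ⟨e, b, s⟩ := c
  by_cases he : e ∈ A <;>
    simp [BoundaryStep, he, state, standardLabelling, Corner.shift, Corner.alongSide,
      Corner.acrossArc, Transition.add]

theorem quot_mk_eq_iff (A : Finset E) (c d : Corner E) :
    Quot.mk (G.BoundaryStep A) c = Quot.mk _ d ↔
      circuit G.next (state standardLabelling A) c d := by
  rw [Quot.eq, boundaryStep_eq]
  rfl

theorem boundaryLocation_surjective (A : Finset E) :
    Function.Surjective (G.boundaryLocation A) := by
  intro K
  induction K using Quot.inductionOn with | _ v
  by_cases hv : G.IsIsolated v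
  · exact ⟨.inr ⟨v, hv⟩, rfl⟩
  · simp only [IsIsolated, not_forall, not_not] at hv
    obtain ⟨e, b, rfl⟩ := hv
    exact ⟨.inl (Quot.mk _ (e, b, false)), rfl⟩

/-- Corners at the same vertex lie on the same boundary component of a spanning state. -/
theorem quot_mk_eq_of_vertexAt_eq {A : Finset E}
    (h : Spanning G.next (state standardLabelling A)) {c d : Corner E}
    (hcd : G.vertexAt c.1 c.2.1 = G.vertexAt d.1 d.2.1) :
    Quot.mk (G.BoundaryStep A) c = Quot.mk _ d := by
  rw [quot_mk_eq_iff]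
  have hle : Relation.EqvGen.setoid (fun x y => y = G.next x ∨ y = x.acrossArc) ≤
      circuit G.next (state standardLabelling A) := by
    refine Setoid.eqvGen_le ?_
    rintro x y (rfl | rfl)
    · exact circuit_next _ _
    · exact h _ _ _
  exact hle (G.one_circle c d hcd)

theorem boundaryLocation_injective {A : Finset E}
    (h : Spanning G.next (state standardLabelling A)) :
    Function.Injective (G.boundaryLocation A) := by
  classical
  -- A left inverse of the location map: in a spanning state all corners at one vertex share a
  -- boundary component, so the chosen corner does not matter.
  let g : V → G.BoundaryComponent A := fun v =>
    if hv : ∃ c : Corner E, G.vertexAt c.1 c.2.1 = v then .inl (Quot.mk _ hv.choose)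
    else .inr ⟨v, fun e b hb => hv ⟨(e, b, false), hb⟩⟩
  have hg : ∀ c : Corner E, g (G.vertexAt c.1 c.2.1) = .inl (Quot.mk _ c) := by
    intro c
    have hv : ∃ d : Corner E, G.vertexAt d.1 d.2.1 = G.vertexAt c.1 c.2.1 := ⟨c, rfl⟩
    exact (dif_pos hv).trans (congrArg Sum.inl (G.quot_mk_eq_of_vertexAt_eq h hv.choose_spec))
  have hgi : ∀ v (hv : G.IsIsolated v), g v = .inr ⟨v, hv⟩ := by
    intro v hv
    exact dif_neg fun ⟨c, hc⟩ => hv _ _ hc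
  let f : G.Component → G.BoundaryComponent A := Quot.lift g (by
    rintro _ _ ⟨e, rfl, rfl⟩
    rw [hg (e, false, false), hg (e, true, false)]
    exact congrArg Sum.inl ((G.quot_mk_eq_iff A _ _).2 (h e _ _)))
  refine Function.LeftInverse.injective (g := f) fun b => ?_
  rcases b with b | ⟨v, hv⟩
  · induction b using Quot.inductionOn with | _ c
    exact hg c
  · exact hgi v hv

/-- Feasibility means that the location map is bijective. It is always surjective, and injectivity
amounts to `Spanning`. -/
theorem deltaMatroid_eq_setSystem : G.deltaMatroid = setSystem G.next standardLabelling := by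
  ext A
  have : A ∈ G.deltaMatroid.feasible ↔ Function.Bijective (G.boundaryLocation A) :=
    (Function.bijective_iff_existsUnique _).symm
  rw [this, mem_setSystem]
  constructor
  · intro h e x y
    rw [← quot_mk_eq_iff]
    refine Sum.inl_injective (h.1 (?_ : G.cornerComponent (e, x) = G.cornerComponent (e, y)))
    have key : G.cornerComponent (e, false, false) = G.cornerComponent (e, true, false) :=
      Quot.sound ⟨e, rfl, rfl⟩
    obtain ⟨_ | _, _⟩ := x <;> obtain ⟨_ | _, _⟩ := y <;>
      first | rfl | exact key | exact key.symm
  · exact fun h => ⟨G.boundaryLocation_injective h, G.boundaryLocation_surjective A⟩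

theorem numComponents_eq [Finite E] [Finite V] {A : Finset E}
    (h : Spanning G.next (state standardLabelling A)) :
    G.numComponents = Nat.card (Quotient (circuit G.next (state standardLabelling A))) +
      Nat.card {v // G.IsIsolated v} := by
  have : Nat.card (Quot (G.BoundaryStep A)) =
      Nat.card (Quotient (circuit G.next (state standardLabelling A))) := by
    rw [card_quotient_circuit, boundaryStep_eq]
  have : Finite (Quot (G.BoundaryStep A)) := Quot.finite _
  rw [numComponents, ← Nat.card_congr (Equiv.ofBijective _
    ⟨G.boundaryLocation_injective h, G.boundaryLocation_surjective A⟩), BoundaryComponent,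
    Nat.card_sum]
  omega

/-- The transitions that trace the boundary of the partial Petrial. -/
def petrialState (A : Finset E) (e : E) : Transition := if e ∈ A then diagonal else side

theorem numBoundary_petrial [Fintype E] [Finite V] (A : Finset E) :
    (G.petrial A).numBoundary = Nat.card (Quotient (circuit G.next (petrialState A))) +
      Nat.card {v // G.IsIsolated v} := by
  have hr : Function.Involutive (reverseArcs A) := reverseArcs_reverseArcs A
  have h : Nat.card (Quot ((G.petrial A).BoundaryStep Finset.univ)) =
      Nat.card (Quotient (circuit G.next (petrialState A))) := by
    -- Conjugation by `reverseArcs A` restores the free segments of `G` and turns the sides of the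
    -- edges in `A` into diagonals.
    have hs : ∀ c : Corner E,
        reverseArcs A c.alongSide = (reverseArcs A c).shift (petrialState A c.1) := by
      rintro ⟨e, b, s⟩
      by_cases he : e ∈ A <;> cases b <;>
        simp [reverseArcs, Corner.alongSide, Corner.acrossArc, Corner.shift, petrialState,
          Transition.add, he]
    rw [card_quotient_circuit]
    refine Nat.card_congr (Quot.congr hr.toPerm fun c d => ?_)
    have h₁ : d = (G.petrial A).next c ↔ reverseArcs A d = G.next (reverseArcs A c) :=
      hr.eq_iff.symm
    have h₂ : d = c.alongSide ↔
        reverseArcs A d = (reverseArcs A c).shift (petrialState A (reverseArcs A c).1) := by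
      rw [reverseArcs_fst, ← hs, hr.injective.eq_iff]
    simp only [BoundaryStep, Finset.mem_univ, if_true, Function.Involutive.coe_toPerm]
    rw [h₁, h₂]
  have : Finite (Quot ((G.petrial A).BoundaryStep Finset.univ)) := Quot.finite _
  rw [numBoundary, BoundaryComponent, Nat.card_sum, h]
  rfl

/-- On `A` the labels run (arc, side), (side, arc), (arc, side), (arc, diagonal), (diagonal, arc);
off `A` they end as (side, arc). The state of `∅` reads the first label. -/
theorem state_dualPivot_standardLabelling [Fintype E] (A : Finset E) :
    state (swapOn A (rotateOn A (swapOn A (swapOn Finset.univ standardLabelling)))) ∅ =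
      petrialState A := by
  ext1 e
  by_cases he : e ∈ A <;>
    simp [state, swapOn, rotateOn, petrialState, standardLabelling, Transition.add, he]

theorem numBoundary_petrial_eq [Fintype E] [Finite V] (A : Finset E) :
    (G.petrial A).numBoundary = G.numComponents +
      ((G.deltaMatroid.twist Finset.univ).dualPivot A).lowerRank := by
  have hl := isLabelling_standardLabelling (E := E)
  obtain ⟨B, hB, -⟩ := exists_spanning_state G.next_next G.next_ne hl
  rw [deltaMatroid_eq_setSystem, dualPivot_twist_univ_setSystem G.next_next G.next_ne hl,
    numBoundary_petrial, G.numComponents_eq hB, ← state_dualPivot_standardLabelling,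
    card_circuits_eq G.next_next G.next_ne ((((hl.swapOn _).swapOn _).rotateOn _).swapOn _) hB]
  omega

end RibbonGraph

theorem theoremt {V E : Type*} [Fintype V] [Fintype E] [DecidableEq E] (G : RibbonGraph V E) :
    G.deltaMatroid.IsVfSafe ∧
      G.penrose = (X : ℤ[X]) ^ G.numComponents * G.deltaMatroid.penrose := by
  constructor
  · rw [RibbonGraph.deltaMatroid_eq_setSystem]
    exact Transition.isVfSafe_setSystem G.next_next G.next_ne
      RibbonGraph.isLabelling_standardLabelling
  · rw [RibbonGraph.penrose, SetSystem.penrose, Finset.mul_sum]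
    refine Finset.sum_congr rfl fun A _ => ?_
    rw [G.numBoundary_petrial_eq, pow_add]
    ring
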